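/- Let $X$ be a complex Banach space and $B(X)$ the algebra of bounded linear operators on $X$. For $A\in B(X)$ let $\Delta_A:B(X)\to B(X)$, $\Delta_A(T)=AT-TA$. For $x\in X$ the local spectrum $\sigma_A(x)$ is the complement of the set of all $\lambda\in\mathbb{C}$ that have an open neighbourhood $U$ and an analytic function $u:U\to X$ with $(zI-A)u(z)=x$ for all $z\in U$; for closed $F\subseteq\mathbb{C}$ put $X_A(F)=\{x\in X:\sigma_A(x)\subseteq F\}$. The operator $A$ is called decomposable if for every open covering $\{U,W\}$ of $\mathbb{C}$ there are closed $A$-invariant linear subspaces $E,F$ of $X$ with $E+F=X$, $\sigma(A|_E)\subseteq U$ and $\sigma(A|_F)\subseteq W$. Let $[\alpha]$ denote the integer part of $\alpha$. **Proposition 3.1.** Let $A\in B(X)$ be decomposable, let $\alpha\ge 0$ be real, and let $T\in B(X)$ satisfy, for some constant $C_T>0$, $$\|e^{nA}Te^{-nA}\|\le C_T(1+|n|)^{\alpha}\qquad\text{for all } n\in\mathbb{Z}.$$ Then the following conditions are equivalent: (a) $T X_A(F)\subseteq X_A(F)$ for every closed set $F\subseteq\mathbb{C}$; (b) $\Delta_A^{[\alpha]+1}(T)=0$.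 In particular, if $0\le\alpha<1$, then $AT=TA$ if and only if $TX_A(F)\subseteq X_A(F)$ for every closed set $F\subseteq\mathbb{C}$. -/

import Mathlib

section LocalSpectralTheory

variable {X : Type*} [NormedAddCommGroup X] [NormedSpace ℂ X]

/-- The inner derivation `Δ_A : T ↦ A T - T A`, a bounded operator on `B(X)`. -/
noncomputable def innerDer (A : X →L[ℂ] X) : (X →L[ℂ] X) →L[ℂ] (X →L[ℂ] X) :=
  ContinuousLinearMap.mul ℂ (X →L[ℂ] X) A - (ContinuousLinearMap.mul ℂ (X →L[ℂ] X)).flip A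

theorem innerDer_apply (A T : X →L[ℂ] X) : innerDer A T = A * T - T * A := rfl

/-- The local resolvent set `ρ_A(x)`: all `z₀` with an open neighbourhood `U` on which
`(z - A) u(z) = x` has an analytic solution `u : U → X`. -/
def localResolventSet (A : X →L[ℂ] X) (x : X) : Set ℂ :=
  {z₀ | ∃ U : Set ℂ, IsOpen U ∧ z₀ ∈ U ∧ ∃ u : ℂ → X, AnalyticOnNhd ℂ u U ∧
    ∀ z ∈ U, z • u z - A (u z) = x}

/-- The local spectrum `σ_A(x)`, the complement of `ρ_A(x)`. -/
def localSpectrum (A : X →L[ℂ] X) (x : X) : Set ℂ :=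
  (localResolventSet A x)ᶜ

/-- The local spectral subspace `X_A(F) = {x : σ_A(x) ⊆ F}`. -/
def localSpectralSubspace (A : X →L[ℂ] X) (F : Set ℂ) : Submodule ℂ X where
  carrier := {x | localSpectrum A x ⊆ F}
  zero_mem' := fun z hz => absurd
    (show z ∈ localResolventSet A 0 from
      ⟨Set.univ, isOpen_univ, Set.mem_univ z, fun _ => 0, analyticOnNhd_const, by simp⟩) hz
  add_mem' := by
    intro x y hx hy z hz
    by_contra hzF
    have h1 : z ∈ localResolventSet A x := by_contra fun h => hzF (hx h)
    have h2 : z ∈ localResolventSet A y := by_contra fun h => hzF (hy h)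
    obtain ⟨U, hU, hzU, u, hu, hux⟩ := h1
    obtain ⟨V, hV, hzV, v, hv, hvy⟩ := h2
    refine hz ⟨U ∩ V, hU.inter hV, ⟨hzU, hzV⟩, fun w => u w + v w,
      fun w hw => (hu w hw.1).add (hv w hw.2), fun w hw => ?_⟩
    rw [← hux w hw.1, ← hvy w hw.2, smul_add, map_add]
    abel
  smul_mem' := by
    intro c x hx z hz
    by_contra hzF
    have h1 : z ∈ localResolventSet A x := by_contra fun h => hzF (hx h)
    obtain ⟨U, hU, hzU, u, hu, hux⟩ := h1
    refine hz ⟨U, hU, hzU, fun w => c • u w, fun w hw => (hu w hw).const_smul, fun w hw => ?_⟩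
    rw [← hux w hw, smul_sub, map_smul, smul_comm]

/-- `A` is decomposable: for every open covering `{U, W}` of `ℂ` there are closed `A`-invariant
subspaces `E`, `F` with `E + F = X`, `σ(A|_E) ⊆ U` and `σ(A|_F) ⊆ W`. -/
def IsDecomposable (A : X →L[ℂ] X) : Prop :=
  ∀ U W : Set ℂ, IsOpen U → IsOpen W → U ∪ W = Set.univ →
    ∃ (E F : Submodule ℂ X) (hE : ∀ x ∈ E, A x ∈ E) (hF : ∀ x ∈ F, A x ∈ F),
      IsClosed (E : Set X) ∧ IsClosed (F : Set X) ∧ E ⊔ F = ⊤ ∧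
      spectrum ℂ (A.restrict hE) ⊆ U ∧ spectrum ℂ (A.restrict hF) ⊆ W

end LocalSpectralTheory

/-! ### Commutators and the local resolvent equation. -/

section Commutator

variable {X : Type*} [NormedAddCommGroup X] [NormedSpace ℂ X]

/-! (b) ⇒ (a): if `(z - A) u = x` locally, the finite sum of `(-1)^k / k! • Δ^k(T) u^{(k)}` solves
the equation for `T x` on the same open set; the terms telescope and the remainder contains
`Δ^{N+1}(T) = 0`.

(a) ⇒ (b): for each `x` the function `f(z) = e^{zA} T e^{-zA} x` is entire of exponential type,
grows at most like `|z|^α` on the real axis, and has `Δ^k(T) x` as its `k`-th derivative at `0`. If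
`f` has type zero along both imaginary half-axes, Phragmén–Lindelöf in the upper and lower
half-planes (`norm_le_rpow_of_right_half_plane`) extends the polynomial bound to the plane, and
Cauchy's estimates kill the derivatives of order `k > α`.

Type zero is where decomposability and (a) enter (`IsDecomposable.exists_norm_conj_exp_apply_le`).
After a rotation the ray is the positive real axis. Vectors with local spectrum in `Re ≤ a` have
growth at most `e^{tb}` under `e^{tA}` for each `b > a`. If the local spectrum lies in a thin
vertical strip, the growth of `e^{-sA}` and that of `e^{sA}` nearly cancel, because `T` does not
push local spectra across the right edge. Decomposability writes every vector as a finite sum of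
such pieces. -/

theorem innerDer_pow_succ_apply (A T : X →L[ℂ] X) (k : ℕ) :
    (innerDer A ^ (k + 1)) T = A * (innerDer A ^ k) T - (innerDer A ^ k) T * A := by
  rw [pow_succ', mul_apply_eq_comp, innerDer_apply]

/-- Differentiating the local resolvent equation `k + 1` times. -/
theorem iteratedDeriv_local_resolvent [CompleteSpace X] {A : X →L[ℂ] X} {x : X} {U : Set ℂ}
    (hU : IsOpen U) {u : ℂ → X} (hu : AnalyticOnNhd ℂ u U)
    (hux : ∀ z ∈ U, z • u z - A (u z) = x) (k : ℕ) :
    ∀ z ∈ U, z • iteratedDeriv (k + 1) u z - A (iteratedDeriv (k + 1) u z) =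
      -((k + 1 : ℂ) • iteratedDeriv k u z) := by
  have hd : ∀ k : ℕ, ∀ z ∈ U, HasDerivAt (iteratedDeriv k u) (iteratedDeriv (k + 1) u z) z := by
    intro k z hz
    rw [iteratedDeriv_succ]
    have : AnalyticOnNhd ℂ (iteratedDeriv k u) U := by
      rw [iteratedDeriv_eq_iterate]; exact hu.iterated_deriv k
    exact (this z hz).differentiableAt.hasDerivAt
  have hD : ∀ k : ℕ, ∀ z ∈ U, HasDerivAt
      (fun w => w • iteratedDeriv k u w - A (iteratedDeriv k u w))
      (z • iteratedDeriv (k + 1) u z + (1 : ℂ) • iteratedDeriv k u z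
        - A (iteratedDeriv (k + 1) u z)) z := fun k z hz =>
    ((hasDerivAt_id z).smul (hd k z hz)).sub (A.hasFDerivAt.comp_hasDerivAt z (hd k z hz))
  induction k with
  | zero =>
    intro z hz
    have h1 : HasDerivAt (fun w => w • iteratedDeriv 0 u w - A (iteratedDeriv 0 u w)) 0 z := by
      refine (hasDerivAt_const z x).congr_of_eventuallyEq ?_
      filter_upwards [hU.mem_nhds hz] with w hw
      simpa using hux w hw
    have h2 := (hD 0 z hz).unique h1
    simp only [Nat.cast_zero, zero_add, one_smul] at h2 ⊢
    rw [eq_neg_iff_add_eq_zero, ← h2]; abel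
  | succ k ih =>
    intro z hz
    have h1 : HasDerivAt (fun w => w • iteratedDeriv (k + 1) u w - A (iteratedDeriv (k + 1) u w))
        (-((k + 1 : ℂ) • iteratedDeriv (k + 1) u z)) z := by
      refine ((hd k z hz).const_smul (k + 1 : ℂ)).neg.congr_of_eventuallyEq ?_
      filter_upwards [hU.mem_nhds hz] with w hw
      simpa using ih w hw
    have h2 := (hD (k + 1) z hz).unique h1
    push_cast
    rw [add_smul, neg_add, ← h2]; abel

/-- The solution for `T x` is a truncated Taylor-type series in the derivatives of `u`. Only the
last commutator survives the telescoping, and it vanishes by hypothesis. -/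
theorem localResolventSet_subset_of_innerDer_pow_eq_zero [CompleteSpace X] {A T : X →L[ℂ] X}
    {N : ℕ} (hN : (innerDer A ^ (N + 1)) T = 0) (x : X) :
    localResolventSet A x ⊆ localResolventSet A (T x) := by
  rintro z₀ ⟨U, hU, hz₀, u, hu, hux⟩
  have hsum : ∀ n : ℕ, ∀ z ∈ U, ∀ v, v = ∑ k ∈ Finset.range (n + 1), ((-1) ^ k / (k.factorial : ℂ)) •
      (innerDer A ^ k) T (iteratedDeriv k u z) → z • v - A v = T x -
        ((-1) ^ n / (n.factorial : ℂ)) • (innerDer A ^ (n + 1)) T (iteratedDeriv n u z) := by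
    intro n z hz
    induction n with
    | zero =>
      rintro v rfl
      simp only [zero_add, Finset.sum_range_one, pow_zero, Nat.factorial_zero, Nat.cast_one,
        div_one, one_smul, innerDer_pow_succ_apply]
      rw [← hux z hz]
      simp
    | succ n ih =>
      rintro v rfl
      rw [Finset.sum_range_succ, smul_add, map_add, add_sub_add_comm, ih _ rfl, map_smul,
        smul_comm z, ← smul_sub]
      have h1 := congrArg ((innerDer A ^ (n + 1)) T)
        (iteratedDeriv_local_resolvent hU hu hux n z hz)
      rw [map_sub, map_smul, map_neg, map_smul] at h1
      have h2 : A ((innerDer A ^ (n + 1)) T (iteratedDeriv (n + 1) u z)) =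
          (innerDer A ^ (n + 1 + 1)) T (iteratedDeriv (n + 1) u z) +
          (innerDer A ^ (n + 1)) T (A (iteratedDeriv (n + 1) u z)) := by
        rw [innerDer_pow_succ_apply A T (n + 1)]; simp
      -- The factor `n + 1` from differentiating the resolvent equation turns the new coefficient
      -- into minus the old one, so the previous remainder cancels.
      have h3 : (-1) ^ (n + 1) / ((n + 1).factorial : ℂ) * (n + 1) =
          - ((-1) ^ n / (n.factorial : ℂ)) := by
        have : (n.factorial : ℂ) ≠ 0 := by exact_mod_cast n.factorial_ne_zero
        have : (n + 1 : ℂ) ≠ 0 := by exact_mod_cast n.succ_ne_zero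
        rw [Nat.factorial_succ]; push_cast; field_simp; ring
      rw [h2, sub_add_eq_sub_sub_swap, h1, smul_sub, smul_neg, smul_smul, h3]
      module
  refine ⟨U, hU, hz₀, fun z => ∑ k ∈ Finset.range (N + 1), ((-1) ^ k / (k.factorial : ℂ)) •
      (innerDer A ^ k) T (iteratedDeriv k u z), ?_, fun z hz => ?_⟩
  · refine Finset.analyticOnNhd_fun_sum _ fun k _ z hz => ?_
    have : AnalyticOnNhd ℂ (iteratedDeriv k u) U := by
      rw [iteratedDeriv_eq_iterate]; exact hu.iterated_deriv k
    exact (((innerDer A ^ k) T).comp_analyticOnNhd this z hz).const_smul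
  · rw [hsum N z hz _ rfl, hN]; simp

theorem map_localSpectralSubspace_le_of_innerDer_pow_eq_zero [CompleteSpace X] {A T : X →L[ℂ] X}
    {N : ℕ} (hN : (innerDer A ^ (N + 1)) T = 0) {F : Set ℂ} {x : X}
    (hx : x ∈ localSpectralSubspace A F) : T x ∈ localSpectralSubspace A F :=
  (Set.compl_subset_compl.2 (localResolventSet_subset_of_innerDer_pow_eq_zero hN x)).trans hx

theorem Commute.apply_mem_localSpectralSubspace [CompleteSpace X] {A S : X →L[ℂ] X}
    (h : Commute A S) {F : Set ℂ} {x : X} (hx : x ∈ localSpectralSubspace A F) :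
    S x ∈ localSpectralSubspace A F := by
  refine map_localSpectralSubspace_le_of_innerDer_pow_eq_zero (N := 0) ?_ hx
  rw [zero_add, pow_one, innerDer_apply, h.eq, sub_self]

end Commutator

/-! ### Invariance under nonzero scalar multiples, used to rotate the plane. -/

section Scaling

variable {X : Type*} [NormedAddCommGroup X] [NormedSpace ℂ X]

theorem smul_mem_localResolventSet {A : X →L[ℂ] X} {x : X} {c z : ℂ} (hc : c ≠ 0)
    (hz : z ∈ localResolventSet A x) : c * z ∈ localResolventSet (c • A) x := by
  obtain ⟨U, hU, hzU, u, hu, hux⟩ := hz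
  refine ⟨(fun w => c⁻¹ * w) ⁻¹' U, hU.preimage (by fun_prop), by simpa [hc] using hzU,
    fun w => c⁻¹ • u (c⁻¹ * w), fun w hw => ?_, fun w hw => ?_⟩
  · have h1 : AnalyticAt ℂ (fun w : ℂ => c⁻¹ * w) w := by fun_prop
    exact (AnalyticAt.fun_comp (hu _ hw) h1).const_smul
  · rw [← hux _ hw, smul_apply, map_smul, smul_smul, smul_smul, mul_inv_cancel₀ hc, one_smul,
      mul_comm w]

theorem localSpectrum_smul_subset_iff {A : X →L[ℂ] X} {x : X} {c : ℂ} (hc : c ≠ 0) {F : Set ℂ} :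
    localSpectrum (c • A) x ⊆ F ↔ localSpectrum A x ⊆ (fun z => c * z) ⁻¹' F := by
  constructor
  · intro h z hz
    refine h fun h1 => hz ?_
    have := smul_mem_localResolventSet (inv_ne_zero hc) h1
    rwa [smul_smul, inv_mul_cancel₀ hc, one_smul, ← mul_assoc, inv_mul_cancel₀ hc, one_mul] at this
  · intro h z hz
    have : c⁻¹ * z ∈ localSpectrum A x := fun h1 => hz <| by
      have := smul_mem_localResolventSet hc h1
      rwa [← mul_assoc, mul_inv_cancel₀ hc, one_mul] at this
    simpa [hc] using h this

theorem IsDecomposable.smul {A : X →L[ℂ] X} (hA : IsDecomposable A) {c : ℂ} (hc : c ≠ 0) :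
    IsDecomposable (c • A) := by
  intro U W hU hW hUW
  have hcont : Continuous fun z : ℂ => c * z := by fun_prop
  obtain ⟨E, F, hE, hF, hEc, hFc, hEF, hsE, hsF⟩ := hA _ _ (hU.preimage hcont) (hW.preimage hcont)
    (by rw [← Set.preimage_union, hUW, Set.preimage_univ])
  have key : ∀ (G : Submodule ℂ X) (hG : ∀ x ∈ G, A x ∈ G) (hG' : ∀ x ∈ G, (c • A) x ∈ G)
      (V : Set ℂ), spectrum ℂ (A.restrict hG) ⊆ (fun z => c * z) ⁻¹' V →
      spectrum ℂ ((c • A).restrict hG') ⊆ V := by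
    intro G hG hG' V h z hz
    have h1 : (c • A).restrict hG' = Units.mk0 c hc • A.restrict hG := by
      ext x; simp
    rw [h1, spectrum.unit_smul_eq_smul] at hz
    obtain ⟨w, hw, rfl⟩ := hz
    exact h hw
  exact ⟨E, F, fun x hx => E.smul_mem c (hE x hx), fun x hx => F.smul_mem c (hF x hx), hEc, hFc,
    hEF, key _ _ _ _ hsE, key _ _ _ _ hsF⟩

end Scaling

/-! ### Growth of the exponential from the location of the spectrum. -/

section SemigroupGrowth

open Filter Topology NNReal ENNReal

/-- If the spectral radius of `a` is less than `r`, then `‖a ^ n‖ = O(r ^ n)`. -/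
theorem exists_norm_pow_le_of_spectralRadius_lt {𝔸 : Type*} [NormedRing 𝔸] [NormedAlgebra ℂ 𝔸]
    [CompleteSpace 𝔸] (a : 𝔸) {r : ℝ≥0} (h : spectralRadius ℂ a < r) :
    ∃ C : ℝ, ∀ n : ℕ, ‖a ^ n‖ ≤ C * (r : ℝ) ^ n := by
  have hr : 0 < r := by
    have := zero_le.trans_lt h
    exact_mod_cast this
  have h1 := (spectrum.pow_nnnorm_pow_one_div_tendsto_nhds_spectralRadius a).eventually_lt_const h
  have h2 : ∀ᶠ n : ℕ in atTop, ‖a ^ n‖ ≤ (r : ℝ) ^ n := by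
    filter_upwards [h1, eventually_gt_atTop 0] with n hn hn0
    have h3 := ENNReal.rpow_le_rpow hn.le (Nat.cast_nonneg n)
    rw [← ENNReal.rpow_mul, one_div, inv_mul_cancel₀ (by positivity), ENNReal.rpow_one,
      ENNReal.rpow_natCast] at h3
    exact_mod_cast h3
  have h4 : (fun n : ℕ => a ^ n) =O[atTop] fun n => (r : ℝ) ^ n :=
    Asymptotics.IsBigO.of_bound 1 (by
      filter_upwards [h2] with n hn
      rwa [one_mul, Real.norm_of_nonneg (by positivity)])
  obtain ⟨C, -, hC⟩ := Asymptotics.bound_of_isBigO_nat_atTop h4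
  refine ⟨C, fun n => (hC (pow_ne_zero n (by positivity))).trans_eq ?_⟩
  rw [Real.norm_of_nonneg (by positivity)]

/-- A compact set in `Re < b` lies in the open disc about `-ρ` of radius `ρ + b` once `ρ` is large.
Then `c = a + ρ` has spectral radius below `ρ + b`, so `e^{tc}` grows at most like `e^{t(ρ+b)}`, and
the scalar factor `e^{-tρ}` leaves `e^{tb}`. -/
theorem exists_norm_exp_smul_le {𝔸 : Type*} [NormedRing 𝔸] [NormedAlgebra ℂ 𝔸]
    [CompleteSpace 𝔸] (a : 𝔸) {b : ℝ} (h : ∀ z ∈ spectrum ℂ a, z.re < b) :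
    ∃ C : ℝ, ∀ t : ℝ, 0 ≤ t → ‖NormedSpace.exp ((t : ℂ) • a)‖ ≤ C * Real.exp (t * b) := by
  obtain ⟨ρ, hρ1, hρ⟩ : ∃ ρ : ℝ, 0 < ρ + b ∧ ∀ z ∈ spectrum ℂ a, ‖z + ρ‖ < ρ + b := by
    have hK := spectrum.isCompact (𝕜 := ℂ) a
    -- Squared, the disc condition reads `‖z‖² < 2ρ(b - Re z) + b²`; this quotient bound suffices
    -- and holds by compactness.
    obtain ⟨ρ, hρ⟩ : ∃ ρ : ℝ, ∀ z ∈ spectrum ℂ a, (‖z‖ ^ 2 + 1) / (b - z.re) ≤ ρ := by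
      have : ContinuousOn (fun z : ℂ => (‖z‖ ^ 2 + 1) / (b - z.re)) (spectrum ℂ a) :=
        ContinuousOn.div (by fun_prop) (by fun_prop) fun z hz => (sub_pos.2 (h z hz)).ne'
      obtain ⟨ρ, hρ⟩ := (hK.image_of_continuousOn this).bddAbove
      exact ⟨ρ, fun z hz => hρ ⟨z, hz, rfl⟩⟩
    refine ⟨max ρ (|b| + 1), ?_, fun z hz => ?_⟩
    · linarith [le_max_right ρ (|b| + 1), neg_abs_le b]
    · have h0 := sub_pos.2 (h z hz)
      have h1 := (div_le_iff₀ h0).1 ((hρ z hz).trans (le_max_left ρ (|b| + 1)))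
      have h2 : 0 < max ρ (|b| + 1) + b := by
        linarith [le_max_right ρ (|b| + 1), neg_abs_le b]
      have h3 : 0 < max ρ (|b| + 1) := by
        linarith [le_max_right ρ (|b| + 1), abs_nonneg b]
      generalize max ρ (|b| + 1) = r at *
      refine lt_of_pow_lt_pow_left₀ 2 h2.le ?_
      rw [← Complex.normSq_eq_norm_sq, Complex.normSq_apply] at h1 ⊢
      simp only [Complex.add_re, Complex.add_im, Complex.ofReal_re, Complex.ofReal_im]
      nlinarith [sq_nonneg b, mul_pos h3 h0]
  obtain ⟨r, hr⟩ : ∃ r : ℝ≥0, (r : ℝ) = ρ + b := ⟨⟨_, hρ1.le⟩, rfl⟩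
  rcases subsingleton_or_nontrivial 𝔸 with h𝔸 | h𝔸
  · exact ⟨0, fun t _ => by rw [Subsingleton.elim (NormedSpace.exp _) (0 : 𝔸)]; simp⟩
  obtain ⟨c, hc⟩ : ∃ c : 𝔸, c = a + algebraMap ℂ 𝔸 ρ := ⟨_, rfl⟩
  have hrad : spectralRadius ℂ c < r := by
    refine spectrum.spectralRadius_lt_of_forall_lt c fun z hz => ?_
    rw [hc, ← spectrum.add_singleton_eq] at hz
    obtain ⟨w, hw, _, rfl, rfl⟩ := hz
    rw [← NNReal.coe_lt_coe, hr]
    exact hρ w hw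
  obtain ⟨C, hC⟩ := exists_norm_pow_le_of_spectralRadius_lt c hrad
  refine ⟨C, fun t ht => ?_⟩
  have h1 : NormedSpace.exp ((t : ℂ) • a) =
      Complex.exp (-(t * ρ)) • NormedSpace.exp ((t : ℂ) • c) := by
    let : NormedAlgebra ℚ 𝔸 := NormedAlgebra.restrictScalars ℚ ℂ 𝔸
    have h3 : (t : ℂ) • a = algebraMap ℂ 𝔸 (-(t * ρ)) + (t : ℂ) • c := by
      rw [hc, smul_add, Algebra.algebraMap_eq_smul_one, Algebra.algebraMap_eq_smul_one, smul_smul,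
        neg_smul]
      abel
    rw [h3, NormedSpace.exp_add_of_commute (Algebra.commutes _ _),
      ← NormedSpace.algebraMap_exp_comm, ← Complex.exp_eq_exp_ℂ, ← Algebra.smul_def]
  have h2 : ‖NormedSpace.exp ((t : ℂ) • c)‖ ≤ C * Real.exp (t * r) := by
    rw [NormedSpace.exp_eq_tsum ℂ]
    refine tsum_of_norm_bounded (g := fun n : ℕ => C * ((t * r) ^ n / n.factorial)) ?_ fun n => ?_
    · rw [Real.exp_eq_exp_ℝ]
      exact (NormedSpace.expSeries_div_hasSum_exp (t * r : ℝ)).mul_left C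
    · rw [smul_pow, smul_smul, norm_smul, mul_pow, norm_mul, norm_inv, norm_pow, Complex.norm_real,
        Complex.norm_natCast, Real.norm_of_nonneg ht]
      calc _ ≤ ((n.factorial : ℝ)⁻¹ * t ^ n) * (C * r ^ n) := by gcongr; exact hC n
        _ = _ := by ring
  rw [h1, norm_smul, Complex.norm_exp]
  calc _ ≤ Real.exp (-(t * ρ)) * (C * Real.exp (t * r)) := by
        have : (-(t * ρ : ℂ)).re = -(t * ρ) := by simp
        rw [this]
        gcongr
    _ = _ := by rw [mul_left_comm, ← Real.exp_add, hr]; ring_nf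

end SemigroupGrowth

/-! ### Spectral splitting along vertical lines and single-valued extension. -/

section HalfPlane

open Filter Topology

variable {X : Type*} [NormedAddCommGroup X] [NormedSpace ℂ X]

theorem norm_sub_mul_norm_le_norm_smul_sub (A : X →L[ℂ] X) (z : ℂ) (w : X) :
    (‖z‖ - ‖A‖) * ‖w‖ ≤ ‖z • w - A w‖ := by
  have h1 := norm_sub_norm_le (z • w) (A w)
  rw [norm_smul] at h1
  linarith [A.le_opNorm w]

theorem ContinuousLinearMap.isOpen_resolventSet [CompleteSpace X] (A : X →L[ℂ] X) :
    IsOpen (resolventSet ℂ A) :=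
  spectrum.isOpen_resolventSet (𝕜 := ℂ) A

theorem ContinuousLinearMap.mem_resolventSet_of_norm_lt [CompleteSpace X] {A : X →L[ℂ] X} {z : ℂ}
    (hz : ‖A‖ < ‖z‖) : z ∈ resolventSet ℂ A := by
  refine spectrum.mem_resolventSet_of_norm_lt_mul (𝕜 := ℂ) (a := A) (lt_of_le_of_lt ?_ hz)
  exact mul_le_of_le_one_right (norm_nonneg _) ContinuousLinearMap.norm_id_le

theorem ContinuousLinearMap.analyticOnNhd_resolvent_apply [CompleteSpace X] (A : X →L[ℂ] X)
    (x : X) : AnalyticOnNhd ℂ (fun z => resolvent A z x) (resolventSet ℂ A) := by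
  refine DifferentiableOn.analyticOnNhd (fun z hz => ?_) A.isOpen_resolventSet
  have h1 : DifferentiableAt ℂ (resolvent A) z :=
    (spectrum.hasDerivAt_resolvent_const_left hz).differentiableAt
  exact (h1.clm_apply (differentiableAt_const x)).differentiableWithinAt

theorem ContinuousLinearMap.smul_resolvent_apply_sub (A : X →L[ℂ] X) (x : X) {z : ℂ}
    (hz : z ∈ resolventSet ℂ A) : z • resolvent A z x - A (resolvent A z x) = x := by
  obtain ⟨R, hR⟩ := spectrum.mem_resolventSet_iff.1 hz
  have h1 : ((R : X →L[ℂ] X) * resolvent A z) x = x := by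
    rw [resolvent, ← hR, Ring.inverse_unit, R.mul_inv]; rfl
  rw [hR] at h1
  exact h1

theorem norm_restrict_le (A : X →L[ℂ] X) {M : Submodule ℂ X} (hM : ∀ x ∈ M, A x ∈ M) :
    ‖A.restrict hM‖ ≤ ‖A‖ :=
  ContinuousLinearMap.opNorm_le_bound _ (norm_nonneg _) fun x => A.le_opNorm x

theorem eq_of_notMem_spectrum_restrict {A : X →L[ℂ] X} {M : Submodule ℂ X}
    (hM : ∀ x ∈ M, A x ∈ M) {z : ℂ} (hz : z ∉ spectrum ℂ (A.restrict hM)) {v w : X}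
    (hv : v ∈ M) (hw : w ∈ M) (h : z • v - A v = z • w - A w) : v = w := by
  obtain ⟨R, hR⟩ := (spectrum.notMem_iff.1 hz)
  have h2 : (↑R⁻¹ * (R : M →L[ℂ] M)) ⟨v, hv⟩ = (↑R⁻¹ * (R : M →L[ℂ] M)) ⟨w, hw⟩ := by
    rw [mul_apply_eq_comp, mul_apply_eq_comp, hR]
    congr 1
    exact Subtype.ext h
  rw [R.inv_mul] at h2
  exact congrArg Subtype.val h2

theorem exists_analytic_resolvent_restrict [CompleteSpace X] {A : X →L[ℂ] X} {M : Submodule ℂ X}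
    (hMc : IsClosed (M : Set X)) (hM : ∀ x ∈ M, A x ∈ M) {m : X} (hm : m ∈ M) :
    ∃ v : ℂ → X, AnalyticOnNhd ℂ v (resolventSet ℂ (A.restrict hM)) ∧ (∀ z, v z ∈ M) ∧
      ∀ z ∈ resolventSet ℂ (A.restrict hM), z • v z - A (v z) = m := by
  have : CompleteSpace M := hMc.completeSpace_coe
  exact ⟨fun z => (resolvent (A.restrict hM) z ⟨m, hm⟩ : M),
    M.subtypeL.comp_analyticOnNhd ((A.restrict hM).analyticOnNhd_resolvent_apply ⟨m, hm⟩),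
    fun z => Subtype.prop _, fun z hz =>
    congrArg Subtype.val ((A.restrict hM).smul_resolvent_apply_sub ⟨m, hm⟩ hz)⟩

theorem localSpectrum_subset_spectrum_restrict [CompleteSpace X] {A : X →L[ℂ] X}
    {M : Submodule ℂ X} (hMc : IsClosed (M : Set X)) (hM : ∀ x ∈ M, A x ∈ M) {m : X}
    (hm : m ∈ M) : localSpectrum A m ⊆ spectrum ℂ (A.restrict hM) := by
  have : CompleteSpace M := hMc.completeSpace_coe
  obtain ⟨v, hv, -, hvm⟩ := exists_analytic_resolvent_restrict hMc hM hm
  exact Set.compl_subset_compl.2 fun z hz => ⟨_, (A.restrict hM).isOpen_resolventSet, hz, v, hv, hvm⟩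

theorem localSpectrum_subset_closedBall [CompleteSpace X] (A : X →L[ℂ] X) (x : X) :
    localSpectrum A x ⊆ Metric.closedBall 0 ‖A‖ := by
  have hM : ∀ x ∈ (⊤ : Submodule ℂ X), A x ∈ (⊤ : Submodule ℂ X) := fun _ _ => trivial
  have hc : IsClosed ((⊤ : Submodule ℂ X) : Set X) := isClosed_univ
  have : CompleteSpace (⊤ : Submodule ℂ X) := hc.completeSpace_coe
  refine (localSpectrum_subset_spectrum_restrict hc hM (Submodule.mem_top (x := x))).trans
    fun z hz => ?_
  rw [mem_closedBall_zero_iff]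
  by_contra hlt
  exact hz (ContinuousLinearMap.mem_resolventSet_of_norm_lt
    ((norm_restrict_le A hM).trans_lt (not_le.1 hlt)))

/-- Resolvents of `A` on an invariant subspace `M` preserve `E ∩ M` on a half-plane which
misses the spectrum of `A` on `M`. -/
theorem mem_of_smul_sub_mem_inter [CompleteSpace X] {A : X →L[ℂ] X} {E M : Submodule ℂ X}
    (hEc : IsClosed (E : Set X)) (hMc : IsClosed (M : Set X)) (hE : ∀ x ∈ E, A x ∈ E)
    (hM : ∀ x ∈ M, A x ∈ M) {a : ℝ} (ha : ∀ z ∈ spectrum ℂ (A.restrict hM), a < z.re)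
    {z : ℂ} (hz : z.re < a) {w : X} (hw : w ∈ M) (hwE : z • w - A w ∈ E) : w ∈ E := by
  have : CompleteSpace E := hEc.completeSpace_coe
  have hzM : ∀ z : ℂ, z.re < a → z ∈ resolventSet ℂ (A.restrict hM) := fun z hz =>
    not_not.1 fun h => lt_asymm hz (ha z h)
  have hm : z • w - A w ∈ M := M.sub_mem (M.smul_mem z hw) (hM w hw)
  obtain ⟨v, hv, hvM, hvm⟩ := exists_analytic_resolvent_restrict hMc hM hm
  obtain ⟨e, -, heE, hem⟩ := exists_analytic_resolvent_restrict hEc hE hwE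
  -- Beyond `‖A‖` the operator `z' - A` is bounded below on `X`, so the solutions found in `M` and
  -- in `E` coincide.
  have hlarge : ∀ z' : ℂ, z'.re < a → ‖A‖ < ‖z'‖ → v z' ∈ E := by
    intro z' h1 h2
    have h3 : z' ∈ resolventSet ℂ (A.restrict hE) :=
      ContinuousLinearMap.mem_resolventSet_of_norm_lt ((norm_restrict_le A hE).trans_lt h2)
    have h4 := norm_sub_mul_norm_le_norm_smul_sub A z' (v z' - e z')
    rw [smul_sub, map_sub, sub_sub_sub_comm, hvm z' (hzM z' h1), hem z' h3, sub_self,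
      norm_zero] at h4
    have h5 : ‖v z' - e z'‖ ≤ 0 := by
      by_contra h; push Not at h
      nlinarith [mul_pos (sub_pos.2 h2) h]
    rw [sub_eq_zero.1 (norm_le_zero_iff.1 h5)]
    exact heE z'
  have hH : IsPreconnected {z : ℂ | z.re < a} := (convex_halfSpace_re_lt a).isPreconnected
  have hO : IsOpen {z : ℂ | z.re < a} := isOpen_lt Complex.continuous_re continuous_const
  -- Membership in `E` is vanishing in `X ⧸ E`, so the identity theorem carries it from large `‖z‖`
  -- to the whole half-plane.
  have hπ : AnalyticOnNhd ℂ (fun z => E.mkQL (v z)) {z : ℂ | z.re < a} :=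
    E.mkQL.comp_analyticOnNhd (hv.mono hzM)
  have hz₀ : ((-(|a| + ‖A‖ + 1) : ℝ) : ℂ) ∈ {z : ℂ | z.re < a} := by
    simp only [Set.mem_ofPred_eq, Complex.ofReal_re]
    linarith [neg_abs_le a, norm_nonneg A]
  have h0 : (fun z => E.mkQL (v z)) =ᶠ[𝓝 ((-(|a| + ‖A‖ + 1) : ℝ) : ℂ)] 0 := by
    have h1 : ∀ᶠ z' : ℂ in 𝓝 ((-(|a| + ‖A‖ + 1) : ℝ) : ℂ), ‖A‖ < ‖z'‖ := by
      refine (isOpen_lt continuous_const continuous_norm).mem_nhds ?_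
      rw [Set.mem_ofPred_eq, Complex.norm_real, norm_neg, Real.norm_of_nonneg (by positivity)]
      linarith [abs_nonneg a]
    filter_upwards [h1, hO.mem_nhds hz₀] with z' h1 h2
    exact (Submodule.Quotient.mk_eq_zero E).2 (hlarge z' h2 h1)
  have h6 := hπ.eqOn_zero_of_preconnected_of_eventuallyEq_zero hH hz₀ h0 hz
  have h7 : v z ∈ E := (Submodule.Quotient.mk_eq_zero E).1 h6
  rwa [eq_of_notMem_spectrum_restrict hM (not_not.2 (hzM z hz)) hw (hvM z)
    (hvm z (hzM z hz)).symm]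

/-- For `a < b` there is a closed invariant subspace `E` such that the spectrum of `A` on `E`
lies in `{Re < b}`, while the quotient operator on `X / E` has a resolvent on `{Re < a}`. -/
theorem IsDecomposable.exists_halfPlane [CompleteSpace X] {A : X →L[ℂ] X} (hA : IsDecomposable A)
    {a b : ℝ} (hab : a < b) :
    ∃ (E : Submodule ℂ X) (hE : ∀ x ∈ E, A x ∈ E), IsClosed (E : Set X) ∧
      (∀ z ∈ spectrum ℂ (A.restrict hE), z.re < b) ∧
      (∀ z : ℂ, z.re < a → ∀ w : X, z • w - A w ∈ E → w ∈ E) ∧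
      ∀ x : X, ∃ e ∈ E, ∃ v : ℂ → X, AnalyticOnNhd ℂ v {z | z.re < a} ∧
        ∀ z : ℂ, z.re < a → z • v z - A (v z) = x - e := by
  obtain ⟨E, M, hE, hM, hEc, hMc, hEM, hsE, hsM⟩ := hA {z | z.re < b} {z | a < z.re}
    (isOpen_lt Complex.continuous_re continuous_const)
    (isOpen_lt continuous_const Complex.continuous_re)
    (by
      ext z
      simp only [Set.mem_union, Set.mem_ofPred_eq, Set.mem_univ, iff_true]
      by_contra! h
      linarith [h.1, h.2])
  have hsplit : ∀ x : X, ∃ e ∈ E, ∃ m ∈ M, e + m = x := fun x =>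
    Submodule.mem_sup.1 (hEM ▸ Submodule.mem_top)
  refine ⟨E, hE, hEc, hsE, fun z hz w hw => ?_, fun x => ?_⟩
  · obtain ⟨e, he, m, hm, rfl⟩ := hsplit w
    refine E.add_mem he (mem_of_smul_sub_mem_inter hEc hMc hE hM hsM hz hm ?_)
    rw [smul_add, map_add, add_sub_add_comm] at hw
    exact (E.add_mem_iff_right (E.sub_mem (E.smul_mem z he) (hE e he))).1 hw
  · obtain ⟨e, he, m, hm, rfl⟩ := hsplit x
    obtain ⟨v, hv, -, hvm⟩ := exists_analytic_resolvent_restrict hMc hM hm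
    have hzM : ∀ z : ℂ, z.re < a → z ∈ resolventSet ℂ (A.restrict hM) := fun z hz =>
      not_not.1 fun h => lt_asymm hz (hsM h)
    refine ⟨e, he, v, hv.mono hzM, fun z hz => ?_⟩
    rw [hvm z (hzM z hz), add_sub_cancel_left]

/-- Decomposable operators have the single-valued extension property. -/
theorem IsDecomposable.eq_zero_of_local_resolvent_zero [CompleteSpace X] {A : X →L[ℂ] X}
    (hA : IsDecomposable A) {U : Set ℂ} (hU : IsOpen U) {u : ℂ → X} (hu : AnalyticOnNhd ℂ u U)
    (h : ∀ z ∈ U, z • u z - A (u z) = 0) : ∀ z ∈ U, u z = 0 := by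
  intro z₀ hz₀
  obtain ⟨r, hr, hrU⟩ := Metric.isOpen_iff.1 hU z₀ hz₀
  obtain ⟨E, hE, hEc, hsE, hQ, -⟩ :=
    hA.exists_halfPlane (show z₀.re - r / 4 < z₀.re + r / 4 by linarith)
  have hconn : IsPreconnected (Metric.ball z₀ r) := (convex_ball z₀ r).isPreconnected
  have hmem : ∀ s : ℝ, |s| = r / 2 → z₀ + s ∈ Metric.ball z₀ r := by
    intro s hs
    rw [mem_ball_iff_norm, add_sub_cancel_left, Complex.norm_real, Real.norm_eq_abs, hs]
    linarith
  have h1 := hmem (-(r / 2)) (by rw [abs_neg, abs_of_pos (by linarith)])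
  have h2 := hmem (r / 2) (by rw [abs_of_pos (by linarith)])
  -- Two uses of the identity theorem: near `z₀ - r/2` injectivity modulo `E` puts `u` into `E`,
  -- hence on the whole ball; near `z₀ + r/2`, outside the spectrum of `A` on `E`, this forces `u =
  -- 0`.
  have hEu : ∀ z ∈ Metric.ball z₀ r, u z ∈ E := by
    have h3 : (fun z => E.mkQL (u z)) =ᶠ[𝓝 (z₀ + ((-(r / 2) : ℝ) : ℂ))] 0 := by
      have h4 : ∀ᶠ z : ℂ in 𝓝 (z₀ + ((-(r / 2) : ℝ) : ℂ)), z.re < z₀.re - r / 4 := by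
        refine (isOpen_lt Complex.continuous_re continuous_const).mem_nhds ?_
        simp only [Set.mem_ofPred_eq, Complex.add_re, Complex.ofReal_re]
        linarith
      filter_upwards [h4, Metric.isOpen_ball.mem_nhds h1] with z hz hzb
      refine (Submodule.Quotient.mk_eq_zero E).2 (hQ z hz _ ?_)
      rw [h z (hrU hzb)]
      exact E.zero_mem
    have h5 := (E.mkQL.comp_analyticOnNhd
      (hu.mono hrU)).eqOn_zero_of_preconnected_of_eventuallyEq_zero hconn h1 h3
    exact fun z hz => (Submodule.Quotient.mk_eq_zero E).1 (h5 hz)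
  have h3 : u =ᶠ[𝓝 (z₀ + ((r / 2 : ℝ) : ℂ))] 0 := by
    have h4 : ∀ᶠ z : ℂ in 𝓝 (z₀ + ((r / 2 : ℝ) : ℂ)), z₀.re + r / 4 < z.re := by
      refine (isOpen_lt continuous_const Complex.continuous_re).mem_nhds ?_
      simp only [Set.mem_ofPred_eq, Complex.add_re, Complex.ofReal_re]
      linarith
    filter_upwards [h4, Metric.isOpen_ball.mem_nhds h2] with z hz hzb
    refine eq_of_notMem_spectrum_restrict hE (fun hs => lt_asymm hz (hsE z hs)) (hEu z hzb)
      E.zero_mem ?_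
    rw [h z (hrU hzb)]
    simp
  exact (hu.mono hrU).eqOn_zero_of_preconnected_of_eventuallyEq_zero hconn h2 h3
    (Metric.mem_ball_self hr)

/-- Single-valued extension makes local solutions agree on overlaps, so they glue. -/
theorem IsDecomposable.exists_analyticOnNhd_localResolventSet [CompleteSpace X] {A : X →L[ℂ] X}
    (hA : IsDecomposable A) (x : X) :
    ∃ u : ℂ → X, AnalyticOnNhd ℂ u (localResolventSet A x) ∧
      ∀ z ∈ localResolventSet A x, z • u z - A (u z) = x := by
  have h : ∀ z ∈ localResolventSet A x, ∃ U : Set ℂ, IsOpen U ∧ z ∈ U ∧ ∃ u : ℂ → X,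
    AnalyticOnNhd ℂ u U ∧ ∀ z ∈ U, z • u z - A (u z) = x := fun z hz => hz
  choose! U hU hzU u hu hux using h
  refine ⟨fun z => u z z, fun z hz => ?_, fun z hz => hux z hz z (hzU z hz)⟩
  refine (hu z hz z (hzU z hz)).congr ?_
  filter_upwards [(hU z hz).mem_nhds (hzU z hz)] with w hw
  have hwρ : w ∈ localResolventSet A x := ⟨_, hU z hz, hw, _, hu z hz, hux z hz⟩
  refine sub_eq_zero.1 (hA.eq_zero_of_local_resolvent_zero ((hU z hz).inter (hU w hwρ))
    (u := fun y => u z y - u w y) (fun y hy => (hu z hz y hy.1).sub (hu w hwρ y hy.2))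
    (fun y hy => ?_) w ⟨hw, hzU w hwρ⟩)
  rw [smul_sub, map_sub, sub_sub_sub_comm, hux z hz y hy.1, hux w hwρ y hy.2, sub_self]

/-- A vector whose local spectrum lies to the left of `Re = a` belongs to any `E` as in
`IsDecomposable.exists_halfPlane`. -/
theorem IsDecomposable.mem_of_localSpectrum_re_le [CompleteSpace X] {A : X →L[ℂ] X}
    (hA : IsDecomposable A) {E : Submodule ℂ X} (hEc : IsClosed (E : Set X))
    (hE : ∀ x ∈ E, A x ∈ E) {a a₀ : ℝ} (ha : a₀ < a)
    (hQ : ∀ z : ℂ, z.re < a → ∀ w : X, z • w - A w ∈ E → w ∈ E) {x : X}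
    (hx : ∀ z ∈ localSpectrum A x, z.re ≤ a₀)
    (hv : ∃ e ∈ E, ∃ v : ℂ → X, AnalyticOnNhd ℂ v {z | z.re < a} ∧
        ∀ z : ℂ, z.re < a → z • v z - A (v z) = x - e) : x ∈ E := by
  obtain ⟨e, he, v, hv, hvx⟩ := hv
  obtain ⟨u, hu, hux⟩ := hA.exists_analyticOnNhd_localResolventSet x
  have hρ : ∀ z : ℂ, a₀ < z.re → z ∈ localResolventSet A x := fun z hz =>
    not_not.1 fun h => hz.not_ge (hx z h)
  -- Modulo `E` both `v` and `u` solve the resolvent equation for `x`, so they agree on the strip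
  -- `a₀ < Re z < a`. The glued function is entire and tends to zero at infinity, hence vanishes by
  -- Liouville.
  set g : ℂ → X ⧸ E := fun z => if z.re < a then E.mkQL (v z) else E.mkQL (u z) with hg
  have hgv : ∀ z : ℂ, z.re < a → g z = E.mkQL (v z) := fun z hz => if_pos hz
  have hgu : ∀ z : ℂ, a₀ < z.re → g z = E.mkQL (u z) := by
    intro z hz
    by_cases hza : z.re < a
    · rw [hgv z hza]
      refine (Submodule.Quotient.eq E).2 (hQ z hza _ ?_)
      rw [smul_sub, map_sub, sub_sub_sub_comm, hvx z hza, hux z (hρ z hz), sub_sub_cancel_left]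
      exact E.neg_mem he
    · exact if_neg hza
  have hdiff : Differentiable ℂ g := by
    intro z
    rcases lt_or_ge z.re a with hz | hz
    · have h1 := E.mkQL.differentiableAt.comp z (hv z hz).differentiableAt
      refine h1.congr_of_eventuallyEq ?_
      filter_upwards [(isOpen_lt Complex.continuous_re continuous_const).mem_nhds hz] with w hw
      exact hgv w hw
    · have hz' : a₀ < z.re := ha.trans_le hz
      have h1 := E.mkQL.differentiableAt.comp z (hu z (hρ z hz')).differentiableAt
      refine h1.congr_of_eventuallyEq ?_
      filter_upwards [(isOpen_lt continuous_const Complex.continuous_re).mem_nhds hz'] with w hw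
      exact hgu w hw
  have hbound : ∀ z : ℂ, ‖A‖ < ‖z‖ → ‖g z‖ ≤ (‖x - e‖ + ‖x‖) / (‖z‖ - ‖A‖) := by
    intro z hz
    rw [le_div_iff₀' (sub_pos.2 hz)]
    rcases lt_or_ge z.re a with hza | hza
    · have h1 := norm_sub_mul_norm_le_norm_smul_sub A z (v z)
      rw [hvx z hza] at h1
      rw [hgv z hza]
      calc _ ≤ (‖z‖ - ‖A‖) * ‖v z‖ := by
            gcongr
            exact Submodule.Quotient.norm_mk_le E (v z)
        _ ≤ _ := by linarith [norm_nonneg x]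
    · have h1 := norm_sub_mul_norm_le_norm_smul_sub A z (u z)
      rw [hux z (hρ z (ha.trans_le hza))] at h1
      rw [hgu z (ha.trans_le hza)]
      calc _ ≤ (‖z‖ - ‖A‖) * ‖u z‖ := by
            gcongr
            exact Submodule.Quotient.norm_mk_le E (u z)
        _ ≤ _ := by linarith [norm_nonneg (x - e)]
  have hlim : Tendsto g (cocompact ℂ) (𝓝 0) := by
    have hn := tendsto_norm_cocompact_atTop (E := ℂ)
    refine squeeze_zero_norm' ?_ ((tendsto_atTop_add_const_right _ (-‖A‖) hn).const_div_atTop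
      (‖x - e‖ + ‖x‖))
    filter_upwards [hn.eventually_gt_atTop ‖A‖] with z hz
    exact hbound z hz
  have hz : ((a - 1 : ℝ) : ℂ).re < a := by rw [Complex.ofReal_re]; linarith
  have h0 := hdiff.apply_eq_of_tendsto_cocompact ((a - 1 : ℝ) : ℂ) hlim
  rw [hgv _ hz] at h0
  have h1 : v ((a - 1 : ℝ) : ℂ) ∈ E := (Submodule.Quotient.mk_eq_zero E).1 h0
  have h2 := E.sub_mem (E.smul_mem ((a - 1 : ℝ) : ℂ) h1) (hE _ h1)
  rw [hvx _ hz] at h2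
  exact (E.sub_mem_iff_left he).1 h2

end HalfPlane

/-! ### Subexponential growth of the conjugated orbit. -/

section ExpGrowth

open Filter Topology

variable {X : Type*} [NormedAddCommGroup X] [NormedSpace ℂ X]

theorem ContinuousLinearMap.exp_add_of_commute [CompleteSpace X] {A B : X →L[ℂ] X}
    (h : Commute A B) :
    NormedSpace.exp (A + B) = NormedSpace.exp A * NormedSpace.exp B := by
  let : NormedAlgebra ℚ (X →L[ℂ] X) := NormedAlgebra.restrictScalars ℚ ℂ _
  exact NormedSpace.exp_add_of_commute h

theorem ContinuousLinearMap.commute_exp_right [CompleteSpace X] {A B : X →L[ℂ] X}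
    (h : Commute A B) : Commute A (NormedSpace.exp B) := by
  let : NormedAlgebra ℚ (X →L[ℂ] X) := NormedAlgebra.restrictScalars ℚ ℂ _
  exact Commute.exp_right h

theorem ContinuousLinearMap.norm_exp_le [CompleteSpace X] (A : X →L[ℂ] X) :
    ‖NormedSpace.exp A‖ ≤ Real.exp ‖A‖ := by
  rw [NormedSpace.exp_eq_tsum ℂ]
  refine tsum_of_norm_bounded (g := fun n : ℕ => ‖A‖ ^ n / n.factorial) ?_ fun n => ?_
  · rw [Real.exp_eq_exp_ℝ]
    exact NormedSpace.expSeries_div_hasSum_exp ‖A‖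
  · rw [norm_smul, norm_inv, Complex.norm_natCast, div_eq_inv_mul]
    gcongr
    rcases n.eq_zero_or_pos with rfl | hn
    · rw [pow_zero, pow_zero]; exact ContinuousLinearMap.norm_id_le
    · exact norm_pow_le' A hn

theorem ContinuousLinearMap.hasSum_exp_apply [CompleteSpace X] (A : X →L[ℂ] X) (x : X) :
    HasSum (fun n : ℕ => (n.factorial⁻¹ : ℂ) • (A ^ n) x) (NormedSpace.exp A x) :=
  (NormedSpace.exp_series_hasSum_exp' (𝕂 := ℂ) A).mapL (ContinuousLinearMap.apply ℂ X x)

theorem ContinuousLinearMap.exists_norm_exp_smul_apply_le [CompleteSpace X] (A : X →L[ℂ] X)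
    {b : ℝ} (h : ∀ z ∈ spectrum ℂ A, z.re < b) :
    ∃ C : ℝ, 0 ≤ C ∧ ∀ t : ℝ, 0 ≤ t → ∀ x : X,
      ‖NormedSpace.exp ((t : ℂ) • A) x‖ ≤ C * Real.exp (t * b) * ‖x‖ := by
  obtain ⟨C, hC⟩ := exists_norm_exp_smul_le A h
  have hC0 : 0 ≤ C := by
    have := (norm_nonneg _).trans (hC 0 le_rfl)
    simpa using this
  exact ⟨C, hC0, fun t ht x => (ContinuousLinearMap.le_opNorm _ _).trans (by
    gcongr; exact hC t ht)⟩

theorem ContinuousLinearMap.exp_apply_of_intertwine [CompleteSpace X] {Y : Type*}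
    [NormedAddCommGroup Y] [NormedSpace ℂ Y] [CompleteSpace Y] {A : X →L[ℂ] X} {B : Y →L[ℂ] Y}
    (J : Y →L[ℂ] X) (h : ∀ y, J (B y) = A (J y)) (y : Y) :
    J (NormedSpace.exp B y) = NormedSpace.exp A (J y) := by
  have hpow : ∀ n : ℕ, J ((B ^ n) y) = (A ^ n) (J y) := by
    intro n
    induction n with
    | zero => rfl
    | succ n ih => rw [pow_succ', pow_succ', mul_apply_eq_comp, mul_apply_eq_comp, ← ih, h]
  refine ((B.hasSum_exp_apply y).mapL J).unique ?_
  convert A.hasSum_exp_apply (J y) using 2 with n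
  rw [map_smul, hpow]

/-- All such `x` lie in a single closed invariant subspace on which the spectrum of `A` is in `Re <
b`. Uniformity of `C` in `x` is essential, since the estimate is later applied to vectors that move
with `s`. -/
theorem IsDecomposable.exists_norm_exp_apply_le [CompleteSpace X] {A : X →L[ℂ] X}
    (hA : IsDecomposable A) {a b : ℝ} (hab : a < b) :
    ∃ C : ℝ, 0 ≤ C ∧ ∀ x : X, (∀ z ∈ localSpectrum A x, z.re ≤ a) → ∀ t : ℝ, 0 ≤ t →
      ‖NormedSpace.exp ((t : ℂ) • A) x‖ ≤ C * Real.exp (t * b) * ‖x‖ := by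
  obtain ⟨E, hE, hEc, hsE, hQ, hv⟩ := hA.exists_halfPlane (show (a + b) / 2 < b by linarith)
  have : CompleteSpace E := hEc.completeSpace_coe
  obtain ⟨C, hC0, hC⟩ := (A.restrict hE).exists_norm_exp_smul_apply_le hsE
  refine ⟨C, hC0, fun x hx t ht => ?_⟩
  have hxE : x ∈ E :=
    hA.mem_of_localSpectrum_re_le hEc hE (show a < (a + b) / 2 by linarith) hQ hx (hv x)
  have h1 := ContinuousLinearMap.exp_apply_of_intertwine (A := (t : ℂ) • A)
    (B := (t : ℂ) • A.restrict hE) E.subtypeL (fun _ => rfl) ⟨x, hxE⟩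
  exact (congrArg norm h1).symm.trans_le (hC t ht ⟨x, hxE⟩)

/-- The left edge bounds `e^{-sA} x` by about `e^{-sa}`. This vector stays in the spectral subspace
of `Re ≤ b`, as does its image under `T`, so `e^{sA}` contributes about `e^{sb}`. Each factor takes
half of the slack `ε`. -/
theorem IsDecomposable.exists_norm_conj_exp_apply_le_of_strip [CompleteSpace X]
    {A T : X →L[ℂ] X} (hA : IsDecomposable A)
    (hT : ∀ F : Set ℂ, IsClosed F →
        (localSpectralSubspace A F).map (T : X →ₗ[ℂ] X) ≤ localSpectralSubspace A F)
    {a b ε : ℝ} (hε : 0 < ε) {x : X} (hx : ∀ z ∈ localSpectrum A x, a ≤ z.re ∧ z.re ≤ b) :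
    ∃ C : ℝ, ∀ s : ℝ, 0 ≤ s →
      ‖(NormedSpace.exp ((s : ℂ) • A) * T * NormedSpace.exp (-((s : ℂ) • A))) x‖ ≤
        C * Real.exp (s * (b - a + ε)) := by
  obtain ⟨C₁, hC₁, h₁⟩ := hA.exists_norm_exp_apply_le (show b < b + ε / 2 by linarith)
  obtain ⟨C₂, hC₂, h₂⟩ := (hA.smul (neg_ne_zero.2 one_ne_zero)).exists_norm_exp_apply_le
    (show -a < -a + ε / 2 by linarith)
  have hx' : ∀ z ∈ localSpectrum ((-1 : ℂ) • A) x, z.re ≤ -a := by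
    refine (localSpectrum_smul_subset_iff (neg_ne_zero.2 one_ne_zero)
      (F := {z : ℂ | z.re ≤ -a})).2 fun z hz => ?_
    have := (hx z hz).1
    simpa using this
  refine ⟨C₁ * ‖T‖ * C₂ * ‖x‖, fun s hs => ?_⟩
  set y := NormedSpace.exp (-((s : ℂ) • A)) x with hy
  have hy1 : ‖y‖ ≤ C₂ * Real.exp (s * (-a + ε / 2)) * ‖x‖ := by
    have := h₂ x hx' s hs
    rwa [smul_comm, neg_one_smul] at this
  have hcomm : Commute A (NormedSpace.exp (-((s : ℂ) • A))) :=
    ContinuousLinearMap.commute_exp_right ((Commute.refl A).smul_right _).neg_right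
  have hyF : y ∈ localSpectralSubspace A {z : ℂ | z.re ≤ b} :=
    hcomm.apply_mem_localSpectralSubspace fun z hz => (hx z hz).2
  have hTy : T y ∈ localSpectralSubspace A {z : ℂ | z.re ≤ b} :=
    hT _ (isClosed_le Complex.continuous_re continuous_const) ⟨y, hyF, rfl⟩
  calc _ = ‖NormedSpace.exp ((s : ℂ) • A) (T y)‖ := rfl
    _ ≤ C₁ * Real.exp (s * (b + ε / 2)) * ‖T y‖ := h₁ _ hTy s hs
    _ ≤ C₁ * Real.exp (s * (b + ε / 2)) *
        (‖T‖ * (C₂ * Real.exp (s * (-a + ε / 2)) * ‖x‖)) := by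
      gcongr
      exact (T.le_opNorm y).trans (by gcongr)
    _ = (C₁ * ‖T‖ * C₂ * ‖x‖) * (Real.exp (s * (b + ε / 2)) * Real.exp (s * (-a + ε / 2))) := by
      ring
    _ = _ := by rw [← Real.exp_add]; ring_nf

theorem localSpectrum_sub_subset (A : X →L[ℂ] X) (x y : X) :
    localSpectrum A (x - y) ⊆ localSpectrum A x ∪ localSpectrum A y :=
  (localSpectralSubspace A _).sub_mem (show x ∈ _ from Set.subset_union_left)
    (show y ∈ _ from Set.subset_union_right)

theorem IsDecomposable.exists_add_of_lt [CompleteSpace X] {A : X →L[ℂ] X}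
    (hA : IsDecomposable A) {a b : ℝ} (hab : a < b) (x : X) :
    ∃ y w : X, x = y + w ∧ (∀ z ∈ localSpectrum A y, z.re < b) ∧
      ∀ z ∈ localSpectrum A w, a < z.re := by
  obtain ⟨E, M, hE, hM, hEc, hMc, hEM, hsE, hsM⟩ := hA {z | z.re < b} {z | a < z.re}
    (isOpen_lt Complex.continuous_re continuous_const)
    (isOpen_lt continuous_const Complex.continuous_re)
    (by
      ext z
      simp only [Set.mem_union, Set.mem_ofPred_eq, Set.mem_univ, iff_true]
      by_contra! h
      linarith [h.1, h.2])
  obtain ⟨y, hy, w, hw, rfl⟩ := Submodule.mem_sup.1 (hEM ▸ Submodule.mem_top : x ∈ E ⊔ M)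
  exact ⟨y, w, rfl, fun z hz => hsE (localSpectrum_subset_spectrum_restrict hEc hE hy hz),
    fun z hz => hsM (localSpectrum_subset_spectrum_restrict hMc hM hw hz)⟩

theorem IsDecomposable.exists_norm_conj_exp_apply_le [CompleteSpace X]
    {A T : X →L[ℂ] X} (hA : IsDecomposable A)
    (hT : ∀ F : Set ℂ, IsClosed F →
        (localSpectralSubspace A F).map (T : X →ₗ[ℂ] X) ≤ localSpectralSubspace A F)
    {ε : ℝ} (hε : 0 < ε) (x : X) :
    ∃ C : ℝ, ∀ s : ℝ, 0 ≤ s →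
      ‖(NormedSpace.exp ((s : ℂ) • A) * T * NormedSpace.exp (-((s : ℂ) • A))) x‖ ≤
        C * Real.exp (s * ε) := by
  have hball : ∀ (x : X), ∀ z ∈ localSpectrum A x, |z.re| ≤ ‖A‖ := fun x z hz =>
    (Complex.abs_re_le_norm z).trans
      (mem_closedBall_zero_iff.1 (localSpectrum_subset_closedBall A x hz))
  -- Induction moving the left edge leftwards by `ε / 4`. For `n = 0` the local spectrum is empty,
  -- since it lies in the ball of radius `‖A‖`; any strip then serves.
  have key : ∀ n : ℕ, ∀ x : X, (∀ z ∈ localSpectrum A x, ‖A‖ + 1 - n * (ε / 4) ≤ z.re) →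
      ∃ C : ℝ, ∀ s : ℝ, 0 ≤ s →
      ‖(NormedSpace.exp ((s : ℂ) • A) * T * NormedSpace.exp (-((s : ℂ) • A))) x‖ ≤
        C * Real.exp (s * ε) := by
    intro n
    induction n with
    | zero =>
      intro x hx
      have h1 := hA.exists_norm_conj_exp_apply_le_of_strip hT hε (a := 0) (b := 0) (x := x)
        fun z hz => by
          have h2 := hx z hz
          have h3 := le_abs_self z.re
          have h4 := hball x z hz
          simp only [Nat.cast_zero] at h2
          exact absurd h2 (by linarith)
      simpa using h1
    | succ n ih =>
      intro x hx
      set a := ‖A‖ + 1 - (n + 1 : ℕ) * (ε / 4) with ha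
      have ha' : ‖A‖ + 1 - n * (ε / 4) = a + ε / 4 := by rw [ha]; push_cast; ring
      obtain ⟨y, w, rfl, hy, hw⟩ := hA.exists_add_of_lt
        (show a + ε / 4 < a + ε / 2 by linarith) x
      obtain ⟨C₁, h₁⟩ := ih w fun z hz => by rw [ha']; exact (hw z hz).le
      -- Strip width `ε / 2` plus slack `ε / 2` gives the exponent `ε`. The left edge for `y` is
      -- inherited through `y = (y + w) - w`.
      obtain ⟨C₂, h₂⟩ := hA.exists_norm_conj_exp_apply_le_of_strip hT (half_pos hε)
        (a := a) (b := a + ε / 2) (x := y) fun z hz => by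
          refine ⟨?_, (hy z hz).le⟩
          have h3 := localSpectrum_sub_subset A (y + w) w
          rw [add_sub_cancel_right] at h3
          rcases h3 hz with h4 | h4
          · exact hx z h4
          · linarith [hw z h4]
      refine ⟨C₂ + C₁, fun s hs => ?_⟩
      rw [map_add]
      refine (norm_add_le _ _).trans ?_
      rw [add_mul]
      refine add_le_add ((h₂ s hs).trans_eq ?_) (h₁ s hs)
      ring_nf
  obtain ⟨n, hn⟩ := exists_nat_gt ((‖A‖ + 1 + ‖A‖) / (ε / 4))
  rw [div_lt_iff₀ (by linarith)] at hn
  exact key n x fun z hz => by linarith [hball x z hz, neg_abs_le z.re]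

end ExpGrowth

/-! ### Phragmén–Lindelöf and Cauchy estimates for polynomial growth. -/

section PhragmenLindelof

open Filter Topology Asymptotics Complex

variable {Y : Type*} [NormedAddCommGroup Y] [NormedSpace ℂ Y]

/-- An entire function of exponential type on the right half-plane, of type zero along the
positive reals and of growth `O((1 + |t|) ^ α)` on the imaginary axis, has growth
`O((1 + ‖z‖) ^ α)` on the right half-plane. -/
theorem norm_le_rpow_of_right_half_plane {f : ℂ → Y} (hf : Differentiable ℂ f) {α K B : ℝ}
    (hα : 0 ≤ α) {D : ℝ} (htype : ∀ z, ‖f z‖ ≤ D * Real.exp (B * ‖z‖))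
    (him : ∀ t : ℝ, ‖f (t * I)‖ ≤ K * (1 + |t|) ^ α)
    (hre : ∀ ε : ℝ, 0 < ε → ∃ C : ℝ, ∀ s : ℝ, 0 ≤ s → ‖f s‖ ≤ C * Real.exp (s * ε))
    {z : ℂ} (hz : 0 ≤ z.re) : ‖f z‖ ≤ K * 2 ^ α * (1 + ‖z‖) ^ α := by
  have hK : 0 ≤ K := by
    have := (norm_nonneg _).trans (him 0)
    simpa using this
  have hD : 0 ≤ D := by
    have := (norm_nonneg _).trans (htype 0)
    simpa using this
  have hnorm : ∀ w : ℂ, 0 ≤ w.re → 1 ≤ ‖w + 1‖ := fun w hw => by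
    refine le_trans ?_ (re_le_norm _)
    simpa using hw
  have hpow : ∀ w : ℂ, 0 ≤ w.re → 1 ≤ ‖(w + 1) ^ (α : ℂ)‖ := fun w hw => by
    rw [norm_cpow_real]
    exact Real.one_le_rpow (hnorm w hw) hα
  have hslit : ∀ w : ℂ, 0 ≤ w.re → w + 1 ∈ slitPlane := fun w hw => by
    refine Or.inl ?_
    simp only [add_re, one_re]
    linarith
  have main : ∀ ε : ℝ, 0 < ε → ‖f z‖ ≤ K * 2 ^ α * (1 + ‖z‖) ^ α * Real.exp (ε * z.re) := by
    intro ε hε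
    -- The exponential gives decay along the positive reals; the power absorbs the growth on the
    -- imaginary axis. The shift to `w + 1` avoids the branch cut and keeps the modulus at least
    -- one.
    set g : ℂ → Y := fun w => (Complex.exp (-(ε * w)) / (w + 1) ^ (α : ℂ)) • f w with hg
    have hgn : ∀ w : ℂ, ‖g w‖ = Real.exp (-(ε * w.re)) / ‖(w + 1) ^ (α : ℂ)‖ * ‖f w‖ := by
      intro w
      rw [hg]
      simp only [norm_smul, norm_div, Complex.norm_exp]
      simp
    have hgle : ∀ w : ℂ, 0 ≤ w.re → ‖g w‖ ≤ Real.exp (-(ε * w.re)) * ‖f w‖ := by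
      intro w hw
      rw [hgn]
      gcongr
      exact div_le_self (Real.exp_nonneg _) (hpow w hw)
    have hgd : ∀ w : ℂ, 0 ≤ w.re → DifferentiableAt ℂ g w := by
      intro w hw
      refine DifferentiableAt.smul (DifferentiableAt.div (by fun_prop) ?_ ?_) (hf w)
      · exact DifferentiableAt.cpow (by fun_prop) (by fun_prop) (hslit w hw)
      · exact norm_pos_iff.1 (one_pos.trans_le (hpow w hw))
    have hcl : closure {w : ℂ | 0 < w.re} = {w : ℂ | 0 ≤ w.re} := closure_setOfPred_lt_re 0
    have h1 : ‖g z‖ ≤ K * 2 ^ α := by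
      refine PhragmenLindelof.right_half_plane_of_tendsto_zero_on_real ?_ ?_ ?_ ?_ hz
      · refine DifferentiableOn.diffContOnCl fun w hw => ?_
        rw [hcl] at hw
        exact (hgd w hw).differentiableWithinAt
      · refine ⟨1, one_lt_two, B, IsBigO.of_bound D ?_⟩
        refine mem_inf_of_right fun w hw => ?_
        have hw : 0 < w.re := hw
        rw [Set.mem_ofPred_eq, Real.norm_of_nonneg (Real.exp_nonneg _), Real.rpow_one]
        refine (hgle w hw.le).trans ((mul_le_of_le_one_left (norm_nonneg _) ?_).trans (htype w))
        rw [Real.exp_le_one_iff]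
        nlinarith
      · obtain ⟨C, hC⟩ := hre (ε / 2) (half_pos hε)
        have h2 : Tendsto (fun s : ℝ => C * Real.exp (-(s * (ε / 2)))) atTop (𝓝 0) := by
          have h3 : Tendsto (fun s : ℝ => s * (ε / 2)) atTop atTop :=
            tendsto_id.atTop_mul_const (half_pos hε)
          simpa using (Real.tendsto_exp_neg_atTop_nhds_zero.comp h3).const_mul C
        refine squeeze_zero_norm' ?_ h2
        filter_upwards [eventually_ge_atTop 0] with s hs
        refine (hgle s hs).trans ?_
        rw [ofReal_re]
        calc _ ≤ Real.exp (-(ε * s)) * (C * Real.exp (s * (ε / 2))) := by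
              gcongr; exact hC s hs
          _ = _ := by rw [mul_left_comm, ← Real.exp_add]; ring_nf
      · intro t
        have ht : ((t : ℂ) * I).re = 0 := by simp
        rw [hgn, ht, mul_zero, neg_zero, Real.exp_zero, norm_cpow_real, div_mul_eq_mul_div, one_mul]
        have h2 : 1 + |t| ≤ 2 * ‖(t : ℂ) * I + 1‖ := by
          have h3 := hnorm ((t : ℂ) * I) ht.ge
          have h4 := abs_im_le_norm ((t : ℂ) * I + 1)
          simp only [add_im, mul_im, ofReal_re, I_im, ofReal_im, I_re, one_im] at h4
          simp only [mul_one, mul_zero, add_zero] at h4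
          linarith
        rw [div_le_iff₀ (Real.rpow_pos_of_pos (one_pos.trans_le (hnorm _ ht.ge)) _)]
        refine (him t).trans ?_
        rw [mul_assoc, ← Real.mul_rpow zero_le_two (norm_nonneg _)]
        gcongr
    rw [hgn, norm_cpow_real, div_mul_eq_mul_div,
      div_le_iff₀ (Real.rpow_pos_of_pos (one_pos.trans_le (hnorm _ hz)) _), Real.exp_neg,
      inv_mul_le_iff₀ (Real.exp_pos _)] at h1
    refine h1.trans ?_
    rw [mul_comm (Real.exp _)]
    gcongr
    exact (norm_add_le _ _).trans (by rw [norm_one, add_comm])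
  -- The constants `C` of `hre` have dropped out of the bound, so `ε` may tend to zero.
  have hlim : Tendsto (fun ε : ℝ => K * 2 ^ α * (1 + ‖z‖) ^ α * Real.exp (ε * z.re)) (𝓝[>] 0)
      (𝓝 (K * 2 ^ α * (1 + ‖z‖) ^ α)) := by
    have h1 : Continuous fun ε : ℝ => K * 2 ^ α * (1 + ‖z‖) ^ α * Real.exp (ε * z.re) := by
      fun_prop
    have h2 := (h1.tendsto 0).mono_left (nhdsWithin_le_nhds (s := Set.Ioi 0))
    simpa using h2
  exact ge_of_tendsto hlim (by filter_upwards [self_mem_nhdsWithin] with ε hε using main ε hε)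

/-- Cauchy's estimate on the circle of radius `R` is `O(R ^ (α - n))`, which tends to zero. -/
theorem iteratedDeriv_eq_zero_of_norm_le_rpow [CompleteSpace Y] {f : ℂ → Y}
    (hf : Differentiable ℂ f) {α K : ℝ} (hα : 0 ≤ α) (h : ∀ z, ‖f z‖ ≤ K * (1 + ‖z‖) ^ α)
    {n : ℕ} (hn : α < n) : iteratedDeriv n f 0 = 0 := by
  have hK : 0 ≤ K := by
    have := (norm_nonneg _).trans (h 0)
    simpa using this
  have hb : ∀ R : ℝ, 1 ≤ R →
      ‖iteratedDeriv n f 0‖ ≤ n.factorial * (K * 2 ^ α) * R ^ (-(n - α)) := by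
    intro R hR
    have hR0 : 0 < R := one_pos.trans_le hR
    have h1 := norm_iteratedDeriv_le_of_forall_mem_sphere_norm_le (c := 0) (C := K * (1 + R) ^ α) n
      hR0 hf.diffContOnCl fun z hz => by
        rw [mem_sphere_zero_iff_norm] at hz
        simpa [hz] using h z
    refine h1.trans ?_
    rw [neg_sub, Real.rpow_sub hR0, Real.rpow_natCast, mul_div_assoc', mul_assoc, mul_assoc,
      ← Real.mul_rpow zero_le_two hR0.le]
    gcongr
    linarith
  have hlim := (tendsto_rpow_neg_atTop (sub_pos.2 hn)).const_mul (n.factorial * (K * 2 ^ α))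
  rw [mul_zero] at hlim
  exact norm_le_zero_iff.1 (ge_of_tendsto hlim (by
    filter_upwards [eventually_ge_atTop 1] with R hR using hb R hR))

end PhragmenLindelof

/-! ### The orbit `e^{zA} T e^{-zA}` and its derivatives. -/

section Conjugation

variable {X : Type*} [NormedAddCommGroup X] [NormedSpace ℂ X]

/-- The orbit `z ↦ e^{zA} T e^{-zA}`. -/
noncomputable def conjExp (A T : X →L[ℂ] X) (z : ℂ) : X →L[ℂ] X :=
  NormedSpace.exp (z • A) * T * NormedSpace.exp (-(z • A))

theorem hasDerivAt_conjExp [CompleteSpace X] (A T : X →L[ℂ] X) (z : ℂ) :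
    HasDerivAt (conjExp A T) (conjExp A (innerDer A T) z) z := by
  have h1 : HasDerivAt (fun w : ℂ => NormedSpace.exp (w • A)) (NormedSpace.exp (z • A) * A) z :=
    hasDerivAt_exp_smul_const A z
  have h2 : HasDerivAt (fun w : ℂ => NormedSpace.exp (w • -A)) (-A * NormedSpace.exp (z • -A)) z :=
    hasDerivAt_exp_smul_const' (-A) z
  simp only [smul_neg] at h2
  convert! (h1.mul_const T).mul h2 using 1
  rw [conjExp, innerDer_apply]
  noncomm_ring

theorem conjExp_zero [CompleteSpace X] (A T : X →L[ℂ] X) : conjExp A T 0 = T := by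
  simp [conjExp, NormedSpace.exp_zero]

theorem conjExp_smul (A T : X →L[ℂ] X) (c z : ℂ) : conjExp (c • A) T z = conjExp A T (z * c) := by
  rw [conjExp, conjExp, smul_smul]

theorem norm_conjExp_le [CompleteSpace X] (A T : X →L[ℂ] X) (z : ℂ) :
    ‖conjExp A T z‖ ≤ ‖T‖ * Real.exp (2 * ‖A‖ * ‖z‖) := by
  have h1 := ContinuousLinearMap.norm_exp_le (z • A)
  have h2 := ContinuousLinearMap.norm_exp_le (-(z • A))
  rw [norm_neg] at h2
  rw [norm_smul] at h1 h2
  calc _ ≤ ‖NormedSpace.exp (z • A)‖ * ‖T‖ * ‖NormedSpace.exp (-(z • A))‖ :=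
        (norm_mul_le _ _).trans (by gcongr; exact norm_mul_le _ _)
    _ ≤ Real.exp (‖z‖ * ‖A‖) * ‖T‖ * Real.exp (‖z‖ * ‖A‖) := by gcongr
    _ = ‖T‖ * (Real.exp (‖z‖ * ‖A‖) * Real.exp (‖z‖ * ‖A‖)) := by ring
    _ = _ := by rw [← Real.exp_add]; ring_nf

theorem conjExp_add [CompleteSpace X] (A T : X →L[ℂ] X) (z w : ℂ) :
    conjExp A T (z + w) = conjExp A (conjExp A T w) z := by
  have hc : ∀ c d : ℂ, Commute (c • A) (d • A) := fun c d =>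
    ((Commute.refl A).smul_left c).smul_right d
  have h2 : -((z + w) • A) = -(w • A) + -(z • A) := by rw [add_smul]; abel
  rw [conjExp, conjExp, conjExp, h2, add_smul, ContinuousLinearMap.exp_add_of_commute (hc z w),
    ContinuousLinearMap.exp_add_of_commute (hc w z).neg_left.neg_right]
  simp only [mul_assoc]

theorem iteratedDeriv_conjExp_apply [CompleteSpace X] (A T : X →L[ℂ] X) (x : X) (k : ℕ) :
    iteratedDeriv k (fun z => conjExp A T z x) = fun z => conjExp A ((innerDer A ^ k) T) z x := by
  induction k with
  | zero => simp
  | succ k ih =>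
    rw [iteratedDeriv_succ, ih]
    ext z
    rw [pow_succ', mul_apply_eq_comp]
    exact ((hasDerivAt_conjExp A _ z).clm_apply (hasDerivAt_const z x)).deriv.trans (by simp)

/-- Splitting `t` into integer and fractional parts costs at most `e^{2‖A‖}` for the fractional
part; `2 ^ α` comes from `1 + |⌊t⌋| ≤ 2 (1 + |t|)`. -/
theorem norm_conjExp_ofReal_le [CompleteSpace X] {A T : X →L[ℂ] X} {C α : ℝ} (hα : 0 ≤ α)
    (hC : 0 ≤ C) (h : ∀ n : ℤ, ‖conjExp A T n‖ ≤ C * (1 + |(n : ℝ)|) ^ α) (t : ℝ) :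
    ‖conjExp A T t‖ ≤ C * 2 ^ α * Real.exp (2 * ‖A‖) * (1 + |t|) ^ α := by
  have h1 : (t : ℂ) = (Int.fract t : ℝ) + (⌊t⌋ : ℂ) := by
    have := Int.fract_add_floor t
    exact_mod_cast this.symm
  have h2 : ‖((Int.fract t : ℝ) : ℂ)‖ ≤ 1 := by
    rw [Complex.norm_real, Real.norm_of_nonneg (Int.fract_nonneg t)]
    exact (Int.fract_lt_one t).le
  have h3 : 1 + |(⌊t⌋ : ℝ)| ≤ 2 * (1 + |t|) := by
    have h4 : |(⌊t⌋ : ℝ)| ≤ |t| + 1 := by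
      rw [abs_le]
      constructor
      · linarith [Int.lt_floor_add_one t, neg_abs_le t]
      · linarith [Int.floor_le t, le_abs_self t]
    linarith [abs_nonneg t]
  rw [h1, conjExp_add]
  calc _ ≤ ‖conjExp A T ⌊t⌋‖ * Real.exp (2 * ‖A‖ * ‖((Int.fract t : ℝ) : ℂ)‖) :=
        norm_conjExp_le A _ _
    _ ≤ (C * (2 * (1 + |t|)) ^ α) * Real.exp (2 * ‖A‖ * 1) := by
      gcongr
      exact (h _).trans (by gcongr)
    _ = _ := by rw [Real.mul_rpow zero_le_two (by positivity)]; ring_nf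

/-- Applied vector by vector because the type-zero constants depend on `x`; the resulting bound does
not involve them. -/
theorem IsDecomposable.norm_conjExp_apply_le_of_re_nonneg [CompleteSpace X] {A T : X →L[ℂ] X}
    (hA : IsDecomposable A)
    (hT : ∀ F : Set ℂ, IsClosed F →
        (localSpectralSubspace A F).map (T : X →ₗ[ℂ] X) ≤ localSpectralSubspace A F)
    {α K : ℝ} (hα : 0 ≤ α)
    (h : ∀ t : ℝ, ‖conjExp A T (t * Complex.I)‖ ≤ K * (1 + |t|) ^ α) (x : X) {z : ℂ}
    (hz : 0 ≤ z.re) : ‖conjExp A T z x‖ ≤ K * ‖x‖ * 2 ^ α * (1 + ‖z‖) ^ α := by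
  refine norm_le_rpow_of_right_half_plane (f := fun z => conjExp A T z x)
    (D := ‖T‖ * ‖x‖) (B := 2 * ‖A‖)
    (fun z => (hasDerivAt_conjExp A T z).differentiableAt.clm_apply (differentiableAt_const x))
    hα (fun z => ?_) (fun t => ?_) (fun ε hε => hA.exists_norm_conj_exp_apply_le hT hε x) hz
  · refine (ContinuousLinearMap.le_opNorm _ _).trans ?_
    rw [mul_right_comm]
    gcongr
    exact norm_conjExp_le A T z
  · refine (ContinuousLinearMap.le_opNorm _ _).trans ?_
    rw [mul_right_comm]
    gcongr
    exact h t

theorem map_localSpectralSubspace_smul_le {A T : X →L[ℂ] X}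
    (hT : ∀ F : Set ℂ, IsClosed F →
        (localSpectralSubspace A F).map (T : X →ₗ[ℂ] X) ≤ localSpectralSubspace A F)
    {c : ℂ} (hc : c ≠ 0) (F : Set ℂ) (hF : IsClosed F) :
    (localSpectralSubspace (c • A) F).map (T : X →ₗ[ℂ] X) ≤ localSpectralSubspace (c • A) F := by
  rintro _ ⟨x, hx, rfl⟩
  exact (localSpectrum_smul_subset_iff hc).2 (hT _ (hF.preimage (by fun_prop))
    ⟨x, (localSpectrum_smul_subset_iff hc).1 hx, rfl⟩)

theorem IsDecomposable.innerDer_pow_eq_zero [CompleteSpace X] {A T : X →L[ℂ] X}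
    (hA : IsDecomposable A)
    (hT : ∀ F : Set ℂ, IsClosed F →
        (localSpectralSubspace A F).map (T : X →ₗ[ℂ] X) ≤ localSpectralSubspace A F)
    {α C : ℝ} (hα : 0 ≤ α) (hC : 0 ≤ C)
    (h : ∀ n : ℤ, ‖conjExp A T n‖ ≤ C * (1 + |(n : ℝ)|) ^ α) {k : ℕ} (hk : α < k) :
    (innerDer A ^ k) T = 0 := by
  have hreal := norm_conjExp_ofReal_le hα hC h
  set K := C * 2 ^ α * Real.exp (2 * ‖A‖)
  -- Passing to `±iA` moves the real-axis bound onto the imaginary axis; the two rotated right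
  -- half-planes are the closed upper and lower half-planes, which cover the plane.
  have hrot : ∀ c : ℂ, (c = Complex.I ∨ c = -Complex.I) → ∀ (x : X) (z : ℂ), 0 ≤ z.re →
      ‖conjExp A T (z * c) x‖ ≤ K * ‖x‖ * 2 ^ α * (1 + ‖z‖) ^ α := by
    intro c hc x z hz
    have hc0 : c ≠ 0 := by rcases hc with rfl | rfl <;> simp
    rw [← conjExp_smul]
    refine (hA.smul hc0).norm_conjExp_apply_le_of_re_nonneg
      (map_localSpectralSubspace_smul_le hT hc0) hα (fun t => ?_) x hz
    rw [conjExp_smul]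
    rcases hc with rfl | rfl
    · have := hreal (-t)
      rwa [abs_neg, Complex.ofReal_neg, show (-t : ℂ) = t * Complex.I * Complex.I by
        rw [mul_assoc, Complex.I_mul_I, mul_neg_one]] at this
    · have := hreal t
      rwa [show (t : ℂ) = t * Complex.I * -Complex.I by
        rw [mul_neg, mul_assoc, Complex.I_mul_I, mul_neg_one, neg_neg]] at this
  ext x
  have hbound : ∀ z, ‖conjExp A T z x‖ ≤ K * ‖x‖ * 2 ^ α * (1 + ‖z‖) ^ α := by
    intro z
    rcases le_total 0 z.im with hz | hz
    · have := hrot Complex.I (Or.inl rfl) x (z * -Complex.I) (by simpa using hz)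
      rwa [mul_assoc, neg_mul, Complex.I_mul_I, neg_neg, mul_one, norm_mul, norm_neg,
        Complex.norm_I, mul_one] at this
    · have := hrot (-Complex.I) (Or.inr rfl) x (z * Complex.I) (by simpa using hz)
      rwa [mul_assoc, mul_neg, Complex.I_mul_I, neg_neg, mul_one, norm_mul,
        Complex.norm_I, mul_one] at this
  have h1 := iteratedDeriv_eq_zero_of_norm_le_rpow (f := fun z => conjExp A T z x)
    (fun z => (hasDerivAt_conjExp A T z).differentiableAt.clm_apply (differentiableAt_const x))
    hα hbound hk
  rw [iteratedDeriv_conjExp_apply] at h1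
  simpa only [conjExp_zero, zero_apply] using h1

end Conjugation

theorem proposition3p1 {X : Type*} [NormedAddCommGroup X] [NormedSpace ℂ X] [CompleteSpace X]
    (A T : X →L[ℂ] X) (hA : IsDecomposable A) (α : ℝ) (hα : 0 ≤ α)
    (hT : ∃ C : ℝ, 0 < C ∧ ∀ n : ℤ,
      ‖NormedSpace.exp ((n : ℂ) • A) * T * NormedSpace.exp (-((n : ℂ) • A))‖
        ≤ C * (1 + |(n : ℝ)|) ^ α) :
    ((∀ F : Set ℂ, IsClosed F →
        (localSpectralSubspace A F).map (T : X →ₗ[ℂ] X) ≤ localSpectralSubspace A F) ↔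
      (innerDer A ^ (⌊α⌋₊ + 1)) T = 0) ∧
    (α < 1 → (A * T = T * A ↔ ∀ F : Set ℂ, IsClosed F →
        (localSpectralSubspace A F).map (T : X →ₗ[ℂ] X) ≤ localSpectralSubspace A F)) := by
  obtain ⟨C, hC, h⟩ := hT
  have key : (∀ F : Set ℂ, IsClosed F →
      (localSpectralSubspace A F).map (T : X →ₗ[ℂ] X) ≤ localSpectralSubspace A F) ↔
      (innerDer A ^ (⌊α⌋₊ + 1)) T = 0 := by
    refine ⟨fun hF => hA.innerDer_pow_eq_zero hF hα hC.le h ?_, fun h0 F _ => ?_⟩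
    · exact_mod_cast Nat.lt_floor_add_one α
    · rintro _ ⟨x, hx, rfl⟩
      exact map_localSpectralSubspace_le_of_innerDer_pow_eq_zero h0 hx
  refine ⟨key, fun hα1 => ?_⟩
  rw [key, Nat.floor_eq_zero.2 hα1, zero_add, pow_one, innerDer_apply, sub_eq_zero]
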